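/- **Theorem 1.4.** Let $\alpha=\{A_n:n\ge 1\}$ be a countably infinite partition of $(0,1]$ into non-empty left-open, right-closed intervals, ordered from right to left starting from $A_1$; let $a_n$ be the length of $A_n$ and $t_n=\sum_{k\ge n}a_k$. Assume that $a_{n+1}<a_n$ for all sufficiently large $n$, and that there are $\theta>0$ and a slowly varying function $\psi$ with $t_n=\psi(n)\,n^{-\theta}$ for all $n\ge 1$. (A measurable function $\psi:(0,\infty)\to(0,\infty)$ is slowly varying if $\lim_{x\to\infty}\psi(xy)/\psi(x)=1$ for every $y>0$.) Let $L_\alpha:[0,1]\to[0,1]$ be given by $L_\alpha(0)=0$ and $L_\alpha(x)=(t_n-x)/a_n$ for $x\in A_n$. A point $x\in[0,1]$ has an infinite $\alpha$-Lüroth expansion if $L_\alpha^{k}(x)\neq0$ for all $k\ge0$; its digits $\ell_n(x)\ge1$, $n\ge1$, are then determined by $L_\alpha^{n-1}(x)\in A_{\ell_n(x)}$. Let $(s_n)_{n\ge1}$ be a sequence of positive integers with $s_n\to\infty$, let $N>3$ be a real number, and let $J$ be the set of all $x\in[0,1]$ that have an infinite $\alpha$-Lüroth expansion with $s_n\le\ell_n(x)<N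 s_n$ for all $n\ge1$. Then $$\dim_H J=\sigma,\qquad \sigma:=\liminf_{n\to\infty}\frac{\log(s_1\cdots s_n)}{(1+\theta)\log(s_1\cdots s_n)+\theta\log s_{n+1}} .$$ -/

import Mathlib

open Filter Topology MeasureTheory

noncomputable section

/-- A countable partition `{A_n : n ≥ 1}` of the unit interval (up to the point `0`) into nonempty
left-open, right-closed intervals, ordered from right to left starting from `A_1`.  It is given by
the lengths `a n` of its atoms, `n ≥ 1` (the value `a 0` has no meaning); the atoms are then
`A_n = (t_{n+1}, t_n]`, where `t_n` is the `n`-th tail. -/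
structure LurothPartition where
  /-- the Lebesgue measure of the `n`-th atom, `n ≥ 1` -/
  a : ℕ → ℝ
  a_pos : ∀ n, 1 ≤ n → 0 < a n
  hasSum_a : HasSum (fun k : ℕ => a (k + 1)) 1

namespace LurothPartition

variable (α : LurothPartition)

/-- The `n`-th tail `t_n = ∑_{k ≥ n} a_k`. -/
def t (n : ℕ) : ℝ := ∑' k : ℕ, α.a (n + k)

/-- The `n`-th atom `A_n`, `n ≥ 1`. -/
def atom (n : ℕ) : Set ℝ := Set.Ioc (α.t (n + 1)) (α.t n)

/-- The index `n ≥ 1` of the atom that contains `x`; it is `0` if `x` lies in no atom. -/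
def digit (x : ℝ) : ℕ := sInf {n : ℕ | 1 ≤ n ∧ x ∈ α.atom n}

/-- The `α`-Lüroth map: `x ↦ (t_n - x) / a_n` on `A_n`, and `0 ↦ 0`. -/
def map (x : ℝ) : ℝ :=
  if α.digit x = 0 then 0 else (α.t (α.digit x) - x) / α.a (α.digit x)

/-- The digit `ℓ_n(x)`, `n ≥ 1`, of the `α`-Lüroth expansion of `x`, that is, the index of the atom
that contains `L_α^{n-1}(x)`. -/
def ell (n : ℕ) (x : ℝ) : ℕ := α.digit (α.map^[n - 1] x)

/-- The expansion of `x ∈ [0,1]` is infinite: the orbit of `x` under the `α`-Lüroth map never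
hits `0`. -/
def HasInfiniteExpansion (x : ℝ) : Prop :=
  x ∈ Set.Icc (0 : ℝ) 1 ∧ ∀ k : ℕ, α.map^[k] x ≠ 0

end LurothPartition

/-- Slowly varying functions `ℝ⁺ → ℝ⁺` (values outside of `ℝ⁺` are irrelevant). -/
def IsSlowlyVarying (f : ℝ → ℝ) : Prop :=
  Measurable f ∧ (∀ x, 0 < x → 0 < f x) ∧
    ∀ y : ℝ, 0 < y → Tendsto (fun x : ℝ => f (x * y) / f x) atTop (𝓝 1)

namespace LurothPartition

variable (α : LurothPartition)

/-- `α` is expansive of exponent `θ`: `t_n = ψ(n) n^{-θ}` with `ψ` slowly varying. -/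
def IsExpansive (θ : ℝ) : Prop :=
  0 ≤ θ ∧ ∃ ψ : ℝ → ℝ, IsSlowlyVarying ψ ∧
    ∀ n : ℕ, 1 ≤ n → α.t n = ψ n * (n : ℝ) ^ (-θ)

/-- `α` is eventually decreasing: `a_n < a_{n-1}` for all sufficiently large `n`. -/
def IsEventuallyDecreasing : Prop :=
  ∀ᶠ n : ℕ in atTop, α.a (n + 1) < α.a n

/-- The strict Jarník set: the points with infinite expansion whose digits satisfy
`s_n ≤ ℓ_n(x) < N s_n` for all `n ≥ 1`. -/
def jarnikSet (s : ℕ → ℕ) (N : ℝ) : Set ℝ :=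
  {x | α.HasInfiniteExpansion x ∧
    ∀ n : ℕ, 1 ≤ n → s n ≤ α.ell n x ∧ (α.ell n x : ℝ) < N * (s n : ℝ)}

end LurothPartition

/-- `σ = liminf log(s_1 ⋯ s_n) / ((1 + θ) log(s_1 ⋯ s_n) + θ log s_{n+1})`. -/
def jarnikExponent (s : ℕ → ℕ) (θ : ℝ) : ℝ :=
  liminf (fun n : ℕ =>
    Real.log (∏ i ∈ Finset.Icc 1 n, (s i : ℝ)) /
      ((1 + θ) * Real.log (∏ i ∈ Finset.Icc 1 n, (s i : ℝ)) + θ * Real.log (s (n + 1) : ℝ))) atTop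

end

/-!
Only exponents matter. The lengths satisfy `a_n = n ^ (-(1 + θ) + o(1))`, hence
`t_n = n ^ (-θ + o(1))`, and there are `s_k ^ (1 + o(1))` digits allowed at position `k`. With
`P = s_1 ⋯ s_n` the set `J` is covered by `P ^ (1 + o(1))` cylinders of order `n`, whose parts in
`J` have diameter at most `P ^ (-(1 + θ) + o(1)) * s_{n+1} ^ (-θ + o(1))`. Those `n` for which this
is an efficient covering give `dim J ≤ σ`.

Conversely, code a number `y` by its mixed radix digits, the radix at position `k` being the number
of digits allowed there, and let `g y ∈ J` be the point with the corresponding Lüroth digits. As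
`s_n → ∞`, the digit following the first one in which `g y` and `g y'` differ is not `1`, so the two
points are separated by a fixed proportion of the atoms in between. Thus `g⁻¹` is Hölder continuous
of every exponent less than `σ`, and its values fill an interval.
-/

noncomputable section

/-! ### Exponents of sequences -/

/-- `f = g ^ (c + o(1))`, in logarithmic form. Meaningful for `g → ∞`; where `log (g n) = 0`, the
quotient is the junk value `0`. -/
def HasExponent (f g : ℕ → ℝ) (c : ℝ) : Prop :=
  Tendsto (fun n => Real.log (f n) / Real.log (g n)) atTop (𝓝 c)

namespace HasExponent

variable {f f' g h : ℕ → ℝ} {c d : ℝ}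

lemma mul (hf : HasExponent f h c) (hf' : HasExponent f' h d) (hf₀ : ∀ᶠ n in atTop, f n ≠ 0)
    (hf'₀ : ∀ᶠ n in atTop, f' n ≠ 0) : HasExponent (fun n => f n * f' n) h (c + d) := by
  refine (hf.add hf').congr' ?_
  filter_upwards [hf₀, hf'₀] with n hn hn'
  rw [Real.log_mul hn hn', add_div]

lemma const (hh : Tendsto h atTop atTop) (C : ℝ) : HasExponent (fun _ => C) h 0 :=
  (Real.tendsto_log_atTop.comp hh).const_div_atTop _

lemma const_mul (hf : HasExponent f h c) (hh : Tendsto h atTop atTop)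
    (hf₀ : ∀ᶠ n in atTop, f n ≠ 0) {C : ℝ} (hC : C ≠ 0) : HasExponent (fun n => C * f n) h c :=
  zero_add c ▸ (const hh C).mul hf (Eventually.of_forall fun _ => hC) hf₀

protected lemma refl (hg : Tendsto g atTop atTop) : HasExponent g g 1 := by
  refine tendsto_const_nhds.congr' ?_
  filter_upwards [(Real.tendsto_log_atTop.comp hg).eventually_gt_atTop 0] with n hn
  exact (div_self hn.ne').symm

lemma inv (hf : HasExponent f h c) : HasExponent (fun n => (f n)⁻¹) h (-c) := by
  simpa only [HasExponent, Real.log_inv, neg_div] using Tendsto.neg hf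

lemma comp (hf : HasExponent f h c) {l : ℕ → ℕ} (hl : Tendsto l atTop atTop) :
    HasExponent (f ∘ l) (h ∘ l) c :=
  Tendsto.comp hf hl

lemma trans (hf : HasExponent f g c) (hg : HasExponent g h d) (hg_top : Tendsto g atTop atTop) :
    HasExponent f h (c * d) := by
  refine (Tendsto.mul hf hg).congr' ?_
  filter_upwards [(Real.tendsto_log_atTop.comp hg_top).eventually_gt_atTop 0] with n hn
  exact div_mul_div_cancel₀ hn.ne'

lemma squeeze (hf : HasExponent f h c) (hf' : HasExponent f' h c) (hh : Tendsto h atTop atTop)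
    (hf₀ : ∀ᶠ n in atTop, 0 < f n) (hfg : ∀ᶠ n in atTop, f n ≤ g n)
    (hgf' : ∀ᶠ n in atTop, g n ≤ f' n) : HasExponent g h c := by
  have hlog := (Real.tendsto_log_atTop.comp hh).eventually_gt_atTop 0
  refine tendsto_of_tendsto_of_tendsto_of_le_of_le' hf hf' ?_ ?_
  · filter_upwards [hf₀, hfg, hlog] with n hn hfgn hhn
    exact div_le_div_of_nonneg_right (Real.log_le_log hn hfgn) hhn.le
  · filter_upwards [hf₀, hfg, hgf', hlog] with n hn hfgn hgf'n hhn
    exact div_le_div_of_nonneg_right (Real.log_le_log (hn.trans_le hfgn) hgf'n) hhn.le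

lemma of_le_const_mul (hg : Tendsto g atTop atTop) {b B : ℝ} (hb : 0 < b) (hB : 0 < B)
    (hbf : ∀ᶠ n in atTop, b * g n ≤ f n) (hfB : ∀ᶠ n in atTop, f n ≤ B * g n) :
    HasExponent f g 1 := by
  have hg₀ : ∀ᶠ n in atTop, g n ≠ 0 := hg.eventually_ne_atTop 0
  refine squeeze ((HasExponent.refl hg).const_mul hg hg₀ hb.ne')
    ((HasExponent.refl hg).const_mul hg hg₀ hB.ne') hg ?_ hbf hfB
  filter_upwards [hg.eventually_gt_atTop 0] with n hn using mul_pos hb hn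

lemma comp_of_le_const_mul (hf : HasExponent f (fun n => n) c) {s l : ℕ → ℕ}
    (hs : Tendsto s atTop atTop) {B : ℝ} (hB : 0 < B) (hsl : ∀ᶠ n in atTop, s n ≤ l n)
    (hls : ∀ᶠ n in atTop, (l n : ℝ) ≤ B * s n) :
    HasExponent (fun n => f (l n)) (fun n => s n) c := by
  have hl : Tendsto l atTop atTop := tendsto_atTop_mono' _ hsl hs
  have hls₁ : HasExponent (fun n => l n) (fun n => s n) 1 :=
    of_le_const_mul (tendsto_natCast_atTop_atTop.comp hs) one_pos hB
      (hsl.mono fun n hn => by rw [one_mul]; exact_mod_cast hn) hls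
  simpa only [mul_one, Function.comp_def] using
    (hf.comp hl).trans hls₁ (tendsto_natCast_atTop_atTop.comp hl)

lemma eventually_le_rpow (hf : HasExponent f g c) (hg : Tendsto g atTop atTop)
    (hf₀ : ∀ᶠ n in atTop, 0 < f n) (hcd : c < d) : ∀ᶠ n in atTop, f n ≤ g n ^ d := by
  filter_upwards [Tendsto.eventually_le_const hcd hf, hf₀, hg.eventually_gt_atTop 1]
    with n hn hfn hgn
  rw [div_le_iff₀ (Real.log_pos hgn), ← Real.log_rpow (zero_lt_one.trans hgn)] at hn
  exact (Real.log_le_log_iff hfn (Real.rpow_pos_of_pos (zero_lt_one.trans hgn) d)).1 hn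

/-- Stolz–Cesàro for the logarithms. -/
lemma prod_range (hf : HasExponent f g c) (hf₀ : ∀ n, f n ≠ 0) (hg₁ : ∀ n, 1 ≤ g n)
    (hg : Tendsto g atTop atTop) :
    HasExponent (fun n => ∏ k ∈ Finset.range n, f k) (fun n => ∏ k ∈ Finset.range n, g k) c := by
  have hg_ne (n : ℕ) : g n ≠ 0 := (zero_lt_one.trans_le (hg₁ n)).ne'
  have hlog_nonneg (n : ℕ) : 0 ≤ Real.log (g n) := Real.log_nonneg (hg₁ n)
  have hlog : Tendsto (fun n => Real.log (g n)) atTop atTop := Real.tendsto_log_atTop.comp hg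
  have hsum : Tendsto (fun n => ∑ k ∈ Finset.range n, Real.log (g k)) atTop atTop := by
    rw [← not_summable_iff_tendsto_nat_atTop_of_nonneg hlog_nonneg]
    exact fun h => not_tendsto_atTop_of_tendsto_nhds h.tendsto_atTop_zero hlog
  have herror : (fun n => Real.log (f n) - c * Real.log (g n)) =o[atTop]
      fun n => Real.log (g n) := by
    refine Asymptotics.isLittleO_of_tendsto' ?_ ?_
    · filter_upwards [hlog.eventually_gt_atTop 0] with n hn h0
      exact absurd h0 hn.ne'
    · refine (tendsto_sub_nhds_zero_iff.2 hf).congr' ?_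
      filter_upwards [hlog.eventually_gt_atTop 0] with n hn
      rw [sub_div, mul_div_cancel_right₀ _ hn.ne']
  refine tendsto_sub_nhds_zero_iff.1 <|
    (herror.sum_range hlog_nonneg hsum).tendsto_div_nhds_zero.congr' ?_
  filter_upwards [hsum.eventually_gt_atTop 0] with n hn
  rw [Real.log_prod fun k _ => hf₀ k, Real.log_prod fun k _ => hg_ne k, Finset.sum_sub_distrib,
    ← Finset.mul_sum, sub_div, mul_div_cancel_right₀ _ hn.ne']

end HasExponent

lemma hasExponent_comp_two_pow {u : ℕ → ℝ} {β : ℝ} (hu₀ : ∀ n, 1 ≤ n → 0 < u n)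
    (hu : Tendsto (fun n => u (2 * n) / u n) atTop (𝓝 (2 ^ β))) :
    HasExponent (fun k => u (2 ^ k)) (fun k => 2 ^ k) β := by
  have hpow (k : ℕ) : 0 < u (2 ^ k) := hu₀ _ Nat.one_le_two_pow
  have hstep : Tendsto (fun k => Real.log (u (2 ^ (k + 1))) - Real.log (u (2 ^ k))) atTop
      (𝓝 (β * Real.log 2)) := by
    rw [← Real.log_rpow two_pos]
    refine ((Real.continuousAt_log (Real.rpow_pos_of_pos two_pos β).ne').tendsto.comp
      (hu.comp (tendsto_pow_atTop_atTop_of_one_lt one_lt_two))).congr fun k => ?_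
    simp only [Function.comp_apply, ← pow_succ']
    exact Real.log_div (hpow _).ne' (hpow _).ne'
  have hmean := (hstep.cesaro.add
    (tendsto_inv_atTop_nhds_zero_nat.mul_const (Real.log (u (2 ^ 0))))).div_const (Real.log 2)
  rw [zero_mul, add_zero, mul_div_cancel_right₀ _ (Real.log_pos one_lt_two).ne'] at hmean
  refine hmean.congr fun k => ?_
  rw [Finset.sum_range_sub fun k => Real.log (u (2 ^ k)), Real.log_pow]
  ring

lemma tendsto_natLog_two : Tendsto (Nat.log 2) atTop atTop :=
  tendsto_atTop.2 fun b => (eventually_ge_atTop (2 ^ b)).mono fun _ =>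
    Nat.le_log_of_pow_le one_lt_two

lemma hasExponent_two_pow_log : HasExponent (fun n => 2 ^ Nat.log 2 n) (fun n => n) 1 := by
  refine HasExponent.of_le_const_mul tendsto_natCast_atTop_atTop one_half_pos one_pos
    (Eventually.of_forall fun n => ?_) ((eventually_ge_atTop 1).mono fun n hn => ?_)
  · have : (n : ℝ) < 2 ^ (Nat.log 2 n + 1) := by
      exact_mod_cast Nat.lt_pow_succ_log_self one_lt_two n
    rw [pow_succ'] at this
    linarith
  · rw [one_mul]
    exact_mod_cast Nat.pow_log_le_self 2 (Nat.one_le_iff_ne_zero.1 hn)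

lemma hasExponent_of_tendsto_doubling {u : ℕ → ℝ} {β : ℝ} (hu₀ : ∀ n, 1 ≤ n → 0 < u n)
    (hu_anti : AntitoneOn u (Set.Ici 1))
    (hu : Tendsto (fun n => u (2 * n) / u n) atTop (𝓝 (2 ^ β))) :
    HasExponent u (fun n => n) β := by
  have hdyadic := hasExponent_comp_two_pow hu₀ hu
  have htop : Tendsto (fun k => (2 : ℝ) ^ k) atTop atTop :=
    tendsto_pow_atTop_atTop_of_one_lt one_lt_two
  have hlog_succ : Tendsto (fun n => Nat.log 2 n + 1) atTop atTop :=
    (tendsto_add_atTop_nat 1).comp tendsto_natLog_two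
  have htwo : HasExponent (fun n => 2 ^ (Nat.log 2 n + 1)) (fun n => n) 1 := by
    simp only [pow_succ']
    exact hasExponent_two_pow_log.const_mul tendsto_natCast_atTop_atTop
      (Eventually.of_forall fun n => by positivity) two_ne_zero
  have hlower := (hdyadic.comp hlog_succ).trans htwo (htop.comp hlog_succ)
  have hupper := (hdyadic.comp tendsto_natLog_two).trans hasExponent_two_pow_log
    (htop.comp tendsto_natLog_two)
  rw [mul_one] at hlower hupper
  refine hlower.squeeze hupper tendsto_natCast_atTop_atTop
    (Eventually.of_forall fun n => hu₀ _ Nat.one_le_two_pow) ?_ ?_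
  · filter_upwards [eventually_ge_atTop 1] with n hn
    exact hu_anti hn Nat.one_le_two_pow (Nat.lt_pow_succ_log_self one_lt_two n).le
  · filter_upwards [eventually_ge_atTop 1] with n hn
    exact hu_anti Nat.one_le_two_pow hn (Nat.pow_log_le_self 2 (Nat.one_le_iff_ne_zero.1 hn))

lemma hasExponent_nat_div_two : HasExponent (fun n => (n / 2 : ℕ)) (fun n => n) 1 := by
  refine HasExponent.of_le_const_mul tendsto_natCast_atTop_atTop (b := 1 / 4) (B := 1)
    (by norm_num) one_pos ((eventually_ge_atTop 2).mono fun n hn => ?_)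
    (Eventually.of_forall fun n => ?_)
  · have : n ≤ 4 * (n / 2) := by omega
    have : (n : ℝ) ≤ 4 * (n / 2 : ℕ) := by exact_mod_cast this
    linarith
  · rw [one_mul]
    exact_mod_cast Nat.div_le_self n 2

/-- The product `m_0 ⋯ m_{n-1}` of the first `n` terms of a sequence of natural numbers, as a real
number. It serves both for `s_1 ⋯ s_n`, with `m k = s_{k+1}`, and for place values in mixed
radix `m`. -/
def rangeProd (m : ℕ → ℕ) (n : ℕ) : ℝ := ∏ k ∈ Finset.range n, (m k : ℝ)

section rangeProd

variable {m : ℕ → ℕ}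

lemma rangeProd_succ (m : ℕ → ℕ) (n : ℕ) : rangeProd m (n + 1) = rangeProd m n * m n :=
  Finset.prod_range_succ _ _

lemma rangeProd_nonneg (m : ℕ → ℕ) (n : ℕ) : 0 ≤ rangeProd m n :=
  Finset.prod_nonneg fun _ _ => Nat.cast_nonneg _

lemma one_le_rangeProd (hm : ∀ k, 0 < m k) (n : ℕ) : 1 ≤ rangeProd m n :=
  Finset.one_le_prod fun k _ => by exact_mod_cast hm k

lemma rangeProd_mono (hm : ∀ k, 0 < m k) : Monotone (rangeProd m) :=
  monotone_nat_of_le_succ fun n => by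
    rw [rangeProd_succ]
    exact le_mul_of_one_le_right (rangeProd_nonneg m n) (by exact_mod_cast hm n)

lemma tendsto_rangeProd (hm : ∀ k, 0 < m k) (hm_top : Tendsto m atTop atTop) :
    Tendsto (rangeProd m) atTop atTop := by
  refine (tendsto_add_atTop_iff_nat 1).1
    (tendsto_atTop_mono (fun n => ?_) (tendsto_natCast_atTop_atTop.comp hm_top))
  rw [rangeProd_succ]
  exact le_mul_of_one_le_left (Nat.cast_nonneg _) (one_le_rangeProd hm n)

end rangeProd

/-! ### The exponent `σ` -/

/-- The denominator `(1 + θ) log p + θ log q` in `σ`, where `p n = s_1 ⋯ s_n` and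
`q n = s_{n+1}`. -/
def logScale (θ : ℝ) (p q : ℕ → ℝ) (n : ℕ) : ℝ :=
  (1 + θ) * Real.log (p n) + θ * Real.log (q n)

section logScale

variable {θ d : ℝ} {p q W X Y : ℕ → ℝ}

lemma log_div_logScale_mem_Icc (hθ : 0 ≤ θ) {n : ℕ} (hp : 1 ≤ p n) (hq : 1 ≤ q n) :
    Real.log (p n) / logScale θ p q n ∈ Set.Icc 0 1 := by
  have hP := Real.log_nonneg hp
  have hQ := Real.log_nonneg hq
  unfold logScale
  exact ⟨by positivity,
    div_le_one_of_le₀ (by nlinarith [mul_nonneg hθ hP, mul_nonneg hθ hQ]) (by positivity)⟩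

lemma eventually_logScale_pos (hθ : 0 ≤ θ) (hp : Tendsto p atTop atTop)
    (hq : Tendsto q atTop atTop) : ∀ᶠ n in atTop, 0 < logScale θ p q n := by
  filter_upwards [hp.eventually_gt_atTop 1, hq.eventually_ge_atTop 1] with n hpn hqn
  have hP := Real.log_pos hpn
  have hQ := Real.log_nonneg hqn
  unfold logScale
  positivity

lemma isBoundedUnder_log_left_div_logScale (hθ : 0 ≤ θ) (hp : Tendsto p atTop atTop)
    (hq : Tendsto q atTop atTop) :
    IsBoundedUnder (· ≤ ·) atTop fun n => ‖Real.log (p n) / logScale θ p q n‖ := by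
  refine isBoundedUnder_of_eventually_le (a := 1) ?_
  filter_upwards [hp.eventually_ge_atTop 1, hq.eventually_ge_atTop 1] with n hpn hqn
  have hmem := log_div_logScale_mem_Icc hθ hpn hqn
  rw [Real.norm_of_nonneg hmem.1]
  exact hmem.2

lemma isBoundedUnder_log_right_div_logScale (hθ : 0 < θ) (hp : Tendsto p atTop atTop)
    (hq : Tendsto q atTop atTop) :
    IsBoundedUnder (· ≤ ·) atTop fun n => ‖Real.log (q n) / logScale θ p q n‖ := by
  refine isBoundedUnder_of_eventually_le (a := 1 / θ) ?_
  filter_upwards [hp.eventually_ge_atTop 1, hq.eventually_ge_atTop 1,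
    eventually_logScale_pos hθ.le hp hq] with n hpn hqn hD
  have hP := Real.log_nonneg hpn
  have hQ := Real.log_nonneg hqn
  rw [Real.norm_of_nonneg (by positivity), div_le_div_iff₀ hD hθ, logScale]
  nlinarith [mul_nonneg hθ.le hP]

lemma HasExponent.tendsto_log_sub_div_zero {f g D : ℕ → ℝ} {c : ℝ} (hf : HasExponent f g c)
    (hg : Tendsto g atTop atTop)
    (hD : IsBoundedUnder (· ≤ ·) atTop fun n => ‖Real.log (g n) / D n‖) :
    Tendsto (fun n => (Real.log (f n) - c * Real.log (g n)) / D n) atTop (𝓝 0) := by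
  refine ((tendsto_sub_nhds_zero_iff.2 hf).zero_mul_isBoundedUnder_le hD).congr' ?_
  filter_upwards [(Real.tendsto_log_atTop.comp hg).eventually_gt_atTop 0] with n hn
  have : Real.log (g n) ≠ 0 := hn.ne'
  field_simp

lemma tendsto_log_mul_rpow_sub_log_div_logScale (hθ : 0 < θ) (hp : Tendsto p atTop atTop)
    (hq : Tendsto q atTop atTop) (hW : HasExponent W p 1) (hX : HasExponent X p (-(1 + θ)))
    (hY : HasExponent Y q (-θ)) (hW₀ : ∀ n, 0 < W n) (hX₀ : ∀ n, 0 < X n) (hY₀ : ∀ n, 0 < Y n)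
    (d : ℝ) :
    Tendsto (fun n => (Real.log (W n * (X n * Y n) ^ d) - Real.log (p n)) / logScale θ p q n)
      atTop (𝓝 (-d)) := by
  have hpD := isBoundedUnder_log_left_div_logScale hθ.le hp hq
  have hXY := (hX.tendsto_log_sub_div_zero hp hpD).add
    (hY.tendsto_log_sub_div_zero hq (isBoundedUnder_log_right_div_logScale hθ hp hq))
  have hWXY := ((hW.tendsto_log_sub_div_zero hp hpD).add (hXY.const_mul d)).sub_const d
  rw [add_zero, mul_zero, zero_add, zero_sub] at hWXY
  refine hWXY.congr' ?_
  filter_upwards [eventually_logScale_pos hθ.le hp hq] with n hD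
  have hXYn := mul_pos (hX₀ n) (hY₀ n)
  rw [Real.log_mul (hW₀ n).ne' (Real.rpow_pos_of_pos hXYn d).ne', Real.log_rpow hXYn,
    Real.log_mul (hX₀ n).ne' (hY₀ n).ne']
  field_simp
  rw [logScale]
  ring

lemma eventually_one_le_mul_rpow (hθ : 0 < θ) (hp : Tendsto p atTop atTop)
    (hq : Tendsto q atTop atTop) (hW : HasExponent W p 1) (hX : HasExponent X p (-(1 + θ)))
    (hY : HasExponent Y q (-θ)) (hW₀ : ∀ n, 0 < W n) (hX₀ : ∀ n, 0 < X n) (hY₀ : ∀ n, 0 < Y n)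
    (hd : d < liminf (fun n => Real.log (p n) / logScale θ p q n) atTop) :
    ∀ᶠ n in atTop, 1 ≤ W n * (X n * Y n) ^ d := by
  obtain ⟨d', hdd', hd'⟩ := exists_between hd
  have hlim := tendsto_log_mul_rpow_sub_log_div_logScale hθ hp hq hW hX hY hW₀ hX₀ hY₀ d
  filter_upwards [eventually_lt_of_lt_liminf hd'
    (isBoundedUnder_le_abs.1 (isBoundedUnder_log_left_div_logScale hθ.le hp hq)).2,
    hlim.eventually_const_lt (neg_lt_neg hdd'), eventually_logScale_pos hθ.le hp hq]
    with n hσ hn hD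
  rw [sub_div] at hn
  have hpos : 0 < W n * (X n * Y n) ^ d :=
    mul_pos (hW₀ n) (Real.rpow_pos_of_pos (mul_pos (hX₀ n) (hY₀ n)) d)
  refine ((Real.log_pos_iff hpos.le).1 ?_).le
  exact (div_pos_iff_of_pos_right hD).1 (by linarith)

lemma frequently_mul_rpow_le_one (hθ : 0 < θ) (hp : Tendsto p atTop atTop)
    (hq : Tendsto q atTop atTop) (hW : HasExponent W p 1) (hX : HasExponent X p (-(1 + θ)))
    (hY : HasExponent Y q (-θ)) (hW₀ : ∀ n, 0 < W n) (hX₀ : ∀ n, 0 < X n) (hY₀ : ∀ n, 0 < Y n)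
    (hd : liminf (fun n => Real.log (p n) / logScale θ p q n) atTop < d) :
    ∃ᶠ n in atTop, W n * (X n * Y n) ^ d ≤ 1 := by
  obtain ⟨d', hd', hdd'⟩ := exists_between hd
  have hlim := tendsto_log_mul_rpow_sub_log_div_logScale hθ hp hq hW hX hY hW₀ hX₀ hY₀ d
  have hbdd := (isBoundedUnder_le_abs.1 (isBoundedUnder_log_left_div_logScale hθ.le hp hq)).1
  have hσ := frequently_lt_of_liminf_lt hbdd.isCoboundedUnder_ge hd'
  refine (hσ.and_eventually ((hlim.eventually_lt_const (neg_lt_neg hdd')).and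
    (eventually_logScale_pos hθ.le hp hq))).mono fun n ⟨_, hn, hD⟩ => ?_
  rw [sub_div] at hn
  have hpos : 0 < W n * (X n * Y n) ^ d :=
    mul_pos (hW₀ n) (Real.rpow_pos_of_pos (mul_pos (hX₀ n) (hY₀ n)) d)
  refine (Real.log_nonpos_iff hpos.le).1 (not_lt.1 fun hlog => ?_)
  linarith [div_pos hlog hD]

end logScale

section jarnikExponent

variable {s : ℕ → ℕ} {θ : ℝ}

lemma jarnikExponent_eq_liminf (s : ℕ → ℕ) (θ : ℝ) :
    jarnikExponent s θ = liminf (fun n => Real.log (rangeProd (fun k => s (k + 1)) n) /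
      logScale θ (rangeProd fun k => s (k + 1)) (fun k => s (k + 1)) n) atTop := by
  simp only [jarnikExponent, logScale, rangeProd, Finset.range_eq_Ico,
    Finset.prod_Ico_add' (fun i => (s i : ℝ)) 0 _ 1, zero_add]
  rfl

lemma jarnikExponent_mem_Icc (hθ : 0 ≤ θ) (hs_pos : ∀ n, 1 ≤ n → 1 ≤ s n) :
    jarnikExponent s θ ∈ Set.Icc 0 1 := by
  have hpos (k : ℕ) : 0 < s (k + 1) := hs_pos (k + 1) k.succ_pos
  have hmem (n : ℕ) := log_div_logScale_mem_Icc hθ (one_le_rangeProd hpos n)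
    (q := fun k => s (k + 1)) (by exact_mod_cast hpos n)
  have hle := Eventually.of_forall (f := atTop) fun n => (hmem n).2
  have hge := Eventually.of_forall (f := atTop) fun n => (hmem n).1
  rw [jarnikExponent_eq_liminf]
  exact ⟨le_liminf_of_le (isBoundedUnder_of_eventually_le hle).isCoboundedUnder_ge hge,
    liminf_le_of_frequently_le hle.frequently (isBoundedUnder_of_eventually_ge hge)⟩

end jarnikExponent

/-! ### Hausdorff dimension -/

section HausdorffDimension

open scoped ENNReal NNReal

lemma dimH_le_of_frequently_card_mul_rpow_le {X : Type*} [MetricSpace X] {E : Set X}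
    {ι : ℕ → Type*} [∀ n, Fintype (ι n)] {T : ∀ n, ι n → Set X} {r : ℕ → ℝ} {d : ℝ≥0}
    (hr₀ : ∀ n, 0 ≤ r n) (hr : Tendsto r atTop (𝓝 0))
    (hT : ∀ n i, ∀ x ∈ T n i, ∀ y ∈ T n i, dist x y ≤ r n) (hE : ∀ n, E ⊆ ⋃ i, T n i)
    (hcard : ∃ᶠ n in atTop, Fintype.card (ι n) * r n ^ (d : ℝ) ≤ 1) : dimH E ≤ d := by
  borelize X
  have hdiam (n : ℕ) (i : ι n) : Metric.ediam (T n i) ≤ ENNReal.ofReal (r n) :=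
    Metric.ediam_le fun x hx y hy => by
      rw [edist_dist]
      exact ENNReal.ofReal_le_ofReal (hT n i x hx y hy)
  have hr' : Tendsto (fun n => ENNReal.ofReal (r n)) atTop (𝓝 0) :=
    ENNReal.ofReal_zero ▸ ENNReal.tendsto_ofReal hr
  have hmeasure : μH[d] E ≤ 1 := by
    refine (Measure.hausdorffMeasure_le_liminf_sum d E _ hr' T (Eventually.of_forall hdiam)
      (Eventually.of_forall hE)).trans (liminf_le_of_frequently_le' (hcard.mono fun n hn => ?_))
    calc ∑ i, Metric.ediam (T n i) ^ (d : ℝ) ≤ ∑ _i : ι n, ENNReal.ofReal (r n) ^ (d : ℝ) := by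
          gcongr with i
          exact hdiam n i
      _ = ENNReal.ofReal (Fintype.card (ι n) * r n ^ (d : ℝ)) := by
          rw [Finset.sum_const, Finset.card_univ, nsmul_eq_mul,
            ENNReal.ofReal_rpow_of_nonneg (hr₀ n) d.coe_nonneg,
            ENNReal.ofReal_mul (Nat.cast_nonneg _), ENNReal.ofReal_natCast]
      _ ≤ 1 := ENNReal.ofReal_le_one.2 hn
  exact dimH_le_of_hausdorffMeasure_ne_top (hmeasure.trans_lt ENNReal.one_lt_top).ne

lemma dimH_le_dimH_image_div_of_dist_le_rpow {X Y : Type*} [MetricSpace X] [MetricSpace Y]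
    {g : X → Y} {E : Set X} {d : ℝ≥0} (hd : 0 < d)
    (hg : ∀ x ∈ E, ∀ y ∈ E, dist x y ≤ dist (g x) (g y) ^ (d : ℝ)) :
    dimH E ≤ dimH (g '' E) / d := by
  have hinj : Set.InjOn g E := fun x hx y hy hxy => by
    have := hg x hx y hy
    rw [hxy, dist_self, Real.zero_rpow (by positivity)] at this
    exact dist_le_zero.1 this
  rcases E.eq_empty_or_nonempty with rfl | ⟨x₀, -⟩
  · simp
  have : Nonempty X := ⟨x₀⟩
  have hinv : HolderOnWith 1 d (Function.invFunOn g E) (g '' E) := by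
    rintro _ ⟨x, hx, rfl⟩ _ ⟨y, hy, rfl⟩
    rw [hinj.leftInvOn_invFunOn hx, hinj.leftInvOn_invFunOn hy, edist_dist, edist_dist,
      ENNReal.coe_one, one_mul, ENNReal.ofReal_rpow_of_nonneg dist_nonneg d.coe_nonneg]
    exact ENNReal.ofReal_le_ofReal (hg x hx y hy)
  have := hinv.dimH_image_le hd
  rwa [hinj.leftInvOn_invFunOn.image_image] at this

end HausdorffDimension

/-! ### Mixed radix expansions -/

/-- The integer whose mixed radix expansion consists of the first `n` digits of the fractional part
of `y ≥ 0`, preceded by its integer part. -/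
def mixedRadixFloor (m : ℕ → ℕ) (n : ℕ) (y : ℝ) : ℕ := ⌊rangeProd m n * y⌋₊

/-- The `n`-th digit, counted from `0`, of the fractional part of `y ≥ 0` in mixed radix `m`; the
place value of this digit is `1 / (m_0 ⋯ m_n)`. -/
def mixedRadixDigit (m : ℕ → ℕ) (n : ℕ) (y : ℝ) : ℕ := mixedRadixFloor m (n + 1) y % m n

section mixedRadix

variable {m : ℕ → ℕ} {y y' : ℝ}

lemma mixedRadixDigit_lt (hm : ∀ k, 0 < m k) (n : ℕ) (y : ℝ) : mixedRadixDigit m n y < m n :=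
  Nat.mod_lt _ (hm n)

lemma mixedRadixFloor_succ (hm : ∀ k, 0 < m k) (n : ℕ) (y : ℝ) :
    mixedRadixFloor m (n + 1) y = m n * mixedRadixFloor m n y + mixedRadixDigit m n y := by
  have hdiv : mixedRadixFloor m (n + 1) y / m n = mixedRadixFloor m n y := by
    have : (m n : ℝ) ≠ 0 := by exact_mod_cast (hm n).ne'
    rw [mixedRadixFloor, mixedRadixFloor, ← Nat.floor_div_natCast, rangeProd_succ]
    field_simp
  rw [← hdiv, mixedRadixDigit, Nat.div_add_mod]

lemma mixedRadixFloor_mono (m : ℕ → ℕ) (n : ℕ) : Monotone (mixedRadixFloor m n) := fun _ _ h =>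
  Nat.floor_le_floor (mul_le_mul_of_nonneg_left h (rangeProd_nonneg m n))

lemma mixedRadixFloor_eq_zero (hm : ∀ k, 0 < m k) {n₀ n : ℕ} (hn : n ≤ n₀)
    (hy : rangeProd m n₀ * y < 1) : mixedRadixFloor m n y = 0 := by
  rw [mixedRadixFloor, Nat.floor_eq_zero]
  rcases le_total y 0 with hy₀ | hy₀
  · linarith [mul_nonpos_of_nonneg_of_nonpos (rangeProd_nonneg m n) hy₀]
  · exact (mul_le_mul_of_nonneg_right (rangeProd_mono hm hn) hy₀).trans_lt hy

lemma rangeProd_mul_sub_le (n : ℕ) (hy : 0 ≤ y) :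
    rangeProd m n * (y' - y) ≤ mixedRadixFloor m n y' + 1 - mixedRadixFloor m n y := by
  have h := Nat.floor_le (mul_nonneg (rangeProd_nonneg m n) hy)
  have h' := Nat.lt_floor_add_one (rangeProd m n * y')
  rw [mul_sub, mixedRadixFloor, mixedRadixFloor]
  linarith

lemma exists_mixedRadixFloor_ne (hm_top : Tendsto (rangeProd m) atTop atTop) (hy : 0 ≤ y)
    (hyy' : y < y') : ∃ n, mixedRadixFloor m n y ≠ mixedRadixFloor m n y' := by
  obtain ⟨n, hn⟩ := (hm_top.eventually_gt_atTop (1 / (y' - y))).exists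
  refine ⟨n, fun h => ?_⟩
  have hle := rangeProd_mul_sub_le (m := m) (y' := y') n hy
  rw [div_lt_iff₀ (sub_pos.2 hyy')] at hn
  rw [h] at hle
  linarith

lemma exists_mixedRadixDigit_lt (hm : ∀ k, 0 < m k) (hm_top : Tendsto (rangeProd m) atTop atTop)
    (hy : 0 ≤ y) (hyy' : y < y') {n₀ : ℕ} (hy' : rangeProd m n₀ * y' < 1) :
    ∃ n ≥ n₀, (∀ k < n, mixedRadixDigit m k y = mixedRadixDigit m k y') ∧
      mixedRadixDigit m n y < mixedRadixDigit m n y' ∧ rangeProd m (n + 1) * (y' - y) ≤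
        2 * ((mixedRadixDigit m n y' : ℝ) - mixedRadixDigit m n y) := by
  have hne := exists_mixedRadixFloor_ne hm_top hy hyy'
  have hzero {n : ℕ} (hn : n ≤ n₀) : mixedRadixFloor m n y = mixedRadixFloor m n y' := by
    rw [mixedRadixFloor_eq_zero hm hn hy', mixedRadixFloor_eq_zero hm hn
      ((mul_le_mul_of_nonneg_left hyy'.le (rangeProd_nonneg m n₀)).trans_lt hy')]
  have hfind : n₀ < Nat.find hne := not_le.1 fun h => Nat.find_spec hne (hzero h)
  obtain ⟨n, hn⟩ : ∃ n, Nat.find hne = n + 1 := Nat.exists_eq_succ_of_ne_zero (by omega)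
  have hagree {k : ℕ} (hk : k ≤ n) : mixedRadixFloor m k y = mixedRadixFloor m k y' :=
    not_not.1 (Nat.find_min hne (by omega))
  have hdigit : mixedRadixDigit m n y < mixedRadixDigit m n y' := by
    have hlt := (mixedRadixFloor_mono m _ hyy'.le).lt_of_ne (Nat.find_spec hne)
    rw [hn, mixedRadixFloor_succ hm, mixedRadixFloor_succ hm, hagree le_rfl] at hlt
    omega
  refine ⟨n, by omega, fun k hk => ?_, hdigit, (rangeProd_mul_sub_le (n + 1) hy).trans ?_⟩
  · rw [mixedRadixDigit, mixedRadixDigit, hagree hk]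
  · rw [mixedRadixFloor_succ hm, mixedRadixFloor_succ hm, hagree le_rfl]
    have : (mixedRadixDigit m n y : ℝ) + 1 ≤ mixedRadixDigit m n y' := by exact_mod_cast hdigit
    push_cast
    linarith

end mixedRadix

/-! ### Exponents of lengths and tails -/

namespace LurothPartition

section tails

variable (α : LurothPartition)

lemma summable_a_add {n : ℕ} (hn : 1 ≤ n) : Summable fun k => α.a (n + k) := by
  obtain ⟨m, rfl⟩ := Nat.exists_eq_add_of_le' hn
  exact ((summable_nat_add_iff m).2 α.hasSum_a.summable).congr fun k =>
    congrArg α.a (by omega)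

lemma t_eq_add {n : ℕ} (hn : 1 ≤ n) : α.t n = α.a n + α.t (n + 1) := by
  rw [t, (α.summable_a_add hn).tsum_eq_zero_add, add_zero, t]
  simp only [add_assoc, add_comm 1]

lemma t_one : α.t 1 = 1 := by
  rw [t, ← α.hasSum_a.tsum_eq]
  simp only [add_comm 1]

lemma t_pos {n : ℕ} (hn : 1 ≤ n) : 0 < α.t n :=
  (α.summable_a_add hn).tsum_pos (fun k => (α.a_pos _ (by omega)).le) 0 (α.a_pos _ hn)

lemma t_eq_sum_Ico_add {m n : ℕ} (hm : 1 ≤ m) (hmn : m ≤ n) :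
    α.t m = ∑ i ∈ Finset.Ico m n, α.a i + α.t n := by
  induction n, hmn using Nat.le_induction with
  | base => simp only [Finset.Ico_self, Finset.sum_empty, zero_add]
  | succ n hmn ih =>
    rw [ih, Finset.sum_Ico_succ_top hmn, α.t_eq_add (hm.trans hmn), add_assoc]

lemma antitoneOn_t : AntitoneOn α.t (Set.Ici 1) := fun m hm n _ hmn => by
  rw [α.t_eq_sum_Ico_add hm hmn]
  exact le_add_of_nonneg_left <| Finset.sum_nonneg fun i hi =>
    (α.a_pos i (le_trans hm (Finset.mem_Ico.1 hi).1)).le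

lemma sum_Ico_a_le_t {m : ℕ} (hm : 1 ≤ m) (n : ℕ) : ∑ i ∈ Finset.Ico m n, α.a i ≤ α.t m := by
  rcases le_total m n with hmn | hnm
  · rw [α.t_eq_sum_Ico_add hm hmn]
    exact le_add_of_nonneg_right (α.t_pos (hm.trans hmn)).le
  · rw [Finset.Ico_eq_empty_of_le hnm, Finset.sum_empty]
    exact (α.t_pos hm).le

lemma tendsto_t : Tendsto α.t atTop (𝓝 0) := by
  refine (tendsto_add_atTop_iff_nat 1).1
    ((tendsto_sum_nat_add fun k => α.a (k + 1)).congr fun n => ?_)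
  exact tsum_congr fun k => congrArg α.a (by omega)

end tails

variable {α : LurothPartition} {θ : ℝ}

lemma eventually_a_pos : ∀ᶠ n in atTop, 0 < α.a n :=
  (eventually_ge_atTop 1).mono α.a_pos

lemma IsExpansive.tendsto_t_two_mul_div (h : α.IsExpansive θ) :
    Tendsto (fun n : ℕ => α.t (2 * n) / α.t n) atTop (𝓝 (2 ^ (-θ))) := by
  obtain ⟨-, ψ, ⟨-, hψ_pos, hψ⟩, ht⟩ := h
  have hlim := ((hψ 2 two_pos).comp tendsto_natCast_atTop_atTop).mul_const ((2 : ℝ) ^ (-θ))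
  rw [one_mul] at hlim
  refine hlim.congr' ((eventually_ge_atTop 1).mono fun n hn => ?_)
  have hn₀ : (0 : ℝ) < n := by exact_mod_cast hn
  have hψn := (hψ_pos n hn₀).ne'
  have hnθ := (Real.rpow_pos_of_pos hn₀ (-θ)).ne'
  dsimp only [Function.comp_apply]
  rw [ht n hn, ht (2 * n) (by omega), Nat.cast_mul, Nat.cast_ofNat, mul_comm 2 (n : ℝ),
    Real.mul_rpow hn₀.le two_pos.le]
  field_simp

lemma IsExpansive.hasExponent_t (h : α.IsExpansive θ) : HasExponent α.t (fun n => n) (-θ) :=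
  hasExponent_of_tendsto_doubling (fun _ => α.t_pos) α.antitoneOn_t h.tendsto_t_two_mul_div

lemma IsEventuallyDecreasing.exists_antitoneOn (h : α.IsEventuallyDecreasing) :
    ∃ K, 1 ≤ K ∧ AntitoneOn α.a (Set.Ici K) := by
  obtain ⟨K, hK⟩ := eventually_atTop.1 h
  exact ⟨K + 1, Nat.le_add_left 1 K,
    antitoneOn_nat_Ici_of_succ_le fun n hn => (hK n (Nat.le_of_succ_le hn)).le⟩

lemma IsEventuallyDecreasing.eventually_t_sub_t_le (h : α.IsEventuallyDecreasing) :
    ∀ᶠ n : ℕ in atTop, α.t n - α.t (2 * n) ≤ n * α.a n := by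
  obtain ⟨K, hK, hanti⟩ := h.exists_antitoneOn
  filter_upwards [eventually_ge_atTop K] with n hn
  rw [α.t_eq_sum_Ico_add (hK.trans hn) (n := 2 * n) (by omega), add_sub_cancel_right]
  have hsum : ∀ i ∈ Finset.Ico n (2 * n), α.a i ≤ α.a n := fun i hi =>
    hanti hn (hn.trans (Finset.mem_Ico.1 hi).1) (Finset.mem_Ico.1 hi).1
  simpa only [Nat.card_Ico, two_mul, Nat.add_sub_cancel, nsmul_eq_mul] using
    Finset.sum_le_card_nsmul _ _ _ hsum

lemma IsEventuallyDecreasing.eventually_mul_a_le (h : α.IsEventuallyDecreasing) :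
    ∀ᶠ n : ℕ in atTop, n / 2 * α.a n ≤ α.t (n / 2) := by
  obtain ⟨K, hK, hanti⟩ := h.exists_antitoneOn
  filter_upwards [eventually_ge_atTop (2 * K)] with n hn
  have hsum : ∀ i ∈ Finset.Ico (n / 2) n, α.a n ≤ α.a i := fun i hi => by
    have := Finset.mem_Ico.1 hi
    exact hanti (show K ≤ i by omega) (show K ≤ n by omega) this.2.le
  have hcard : (n : ℝ) / 2 ≤ (Finset.Ico (n / 2) n).card := by
    rw [Nat.card_Ico, Nat.cast_sub (Nat.div_le_self n 2)]
    linarith [Nat.cast_div_le (α := ℝ) (m := n) (n := 2)]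
  calc (n : ℝ) / 2 * α.a n ≤ (Finset.Ico (n / 2) n).card * α.a n :=
        mul_le_mul_of_nonneg_right hcard (α.a_pos n (by omega)).le
    _ ≤ ∑ i ∈ Finset.Ico (n / 2) n, α.a i := by
        simpa only [nsmul_eq_mul] using Finset.card_nsmul_le_sum _ _ _ hsum
    _ ≤ α.t (n / 2) := α.sum_Ico_a_le_t (by omega) n

/-- The monotone density argument: since `t_{2n} / t_n → 2^{-θ} < 1`, the `n` lengths between `n`
and `2n` carry a fixed proportion of `t_n`. -/
lemma hasExponent_a (hθ : 0 < θ) (hexp : α.IsExpansive θ) (hdec : α.IsEventuallyDecreasing) :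
    HasExponent α.a (fun n => n) (-(1 + θ)) := by
  have hnat : Tendsto (fun n : ℕ => (n : ℝ)) atTop atTop := tendsto_natCast_atTop_atTop
  have hnat₀ : ∀ᶠ n : ℕ in atTop, (n : ℝ)⁻¹ ≠ 0 :=
    (hnat.eventually_ne_atTop 0).mono fun n => inv_ne_zero
  have hhalf : Tendsto (fun n => n / 2) atTop atTop := Nat.tendsto_div_const_atTop two_ne_zero
  have ht₀ : ∀ᶠ n in atTop, α.t n ≠ 0 := (eventually_ge_atTop 1).mono fun n hn => (α.t_pos hn).ne'
  have ht_half : HasExponent (fun n => α.t (n / 2)) (fun n => n) (-θ) := by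
    simpa only [mul_one, Function.comp_def] using
      (hexp.hasExponent_t.comp hhalf).trans hasExponent_nat_div_two (hnat.comp hhalf)
  obtain ⟨r, hr, hr₁⟩ := exists_between (Real.rpow_lt_one_of_one_lt_of_neg one_lt_two
    (neg_lt_zero.2 hθ))
  have hinv := (HasExponent.refl hnat).inv
  have hlower := (hinv.mul hexp.hasExponent_t hnat₀ ht₀).const_mul hnat
    (hnat₀.and ht₀ |>.mono fun n hn => mul_ne_zero hn.1 hn.2) (sub_pos.2 hr₁).ne'
  have hupper := (hinv.mul ht_half hnat₀ (hhalf.eventually ht₀)).const_mul hnat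
    (hnat₀.and (hhalf.eventually ht₀) |>.mono fun n hn => mul_ne_zero hn.1 hn.2) two_ne_zero
  rw [neg_add]
  refine hlower.squeeze hupper hnat ?_ ?_ ?_
  · filter_upwards [eventually_ge_atTop 1] with n hn
    exact mul_pos (sub_pos.2 hr₁) (mul_pos (by positivity) (α.t_pos hn))
  · filter_upwards [eventually_ge_atTop 1, hdec.eventually_t_sub_t_le,
      hexp.tendsto_t_two_mul_div.eventually_le_const hr] with n hn hsub hratio
    rw [div_le_iff₀ (α.t_pos hn)] at hratio
    rw [mul_left_comm, inv_mul_le_iff₀ (by exact_mod_cast hn)]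
    linarith
  · filter_upwards [eventually_ge_atTop 1, hdec.eventually_mul_a_le] with n hn hle
    rw [mul_left_comm, le_inv_mul_iff₀ (by exact_mod_cast hn)]
    linarith

/-- A tail of `∑ k ^ (-1 - δ)` splits off the factor `n ^ c` with `c` arbitrarily close to `-θ`. -/
lemma eventually_t_le_rpow (hα : HasExponent α.a (fun n => n) (-(1 + θ))) {c : ℝ} (hc : -θ < c)
    (hc₀ : c ≤ 0) : ∀ᶠ n : ℕ in atTop, α.t n ≤ (n : ℝ) ^ c := by
  obtain ⟨δ, hδ, hδc⟩ := exists_between (neg_lt_iff_pos_add.1 hc)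
  have hsummable : Summable fun k : ℕ => (k : ℝ) ^ (-1 - δ) :=
    Real.summable_nat_rpow.2 (by linarith)
  have htail := (tendsto_sum_nat_add fun k : ℕ => (k : ℝ) ^ (-1 - δ)).eventually_le_const
    zero_lt_one
  have ha := hα.eventually_le_rpow tendsto_natCast_atTop_atTop eventually_a_pos
    (show -(1 + θ) < c + (-1 - δ) by linarith)
  filter_upwards [eventually_ge_atTop 1, htail,
    eventually_forall_ge_atTop.2 ha] with n hn htail_n ha_n
  have hn₀ : (0 : ℝ) < n := by exact_mod_cast hn
  have hterm (k : ℕ) : α.a (n + k) ≤ (n : ℝ) ^ c * ((k + n : ℕ) : ℝ) ^ (-1 - δ) := by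
    have hk : (n : ℝ) ≤ (k + n : ℕ) := by exact_mod_cast Nat.le_add_left n k
    rw [add_comm n k]
    refine (ha_n (k + n) (Nat.le_add_left n k)).trans ?_
    rw [Real.rpow_add (hn₀.trans_le hk)]
    exact mul_le_mul_of_nonneg_right (Real.rpow_le_rpow_of_nonpos hn₀ hk hc₀)
      (Real.rpow_nonneg (Nat.cast_nonneg _) _)
  calc α.t n ≤ ∑' k : ℕ, (n : ℝ) ^ c * ((k + n : ℕ) : ℝ) ^ (-1 - δ) :=
        (α.summable_a_add hn).tsum_le_tsum hterm
          (((summable_nat_add_iff n).2 hsummable).mul_left _)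
    _ = (n : ℝ) ^ c * ∑' k : ℕ, ((k + n : ℕ) : ℝ) ^ (-1 - δ) := tsum_mul_left
    _ ≤ (n : ℝ) ^ c := mul_le_of_le_one_right (Real.rpow_nonneg hn₀.le _) htail_n

lemma hasExponent_t (hθ : 0 < θ) (hα : HasExponent α.a (fun n => n) (-(1 + θ))) :
    HasExponent α.t (fun n => n) (-θ) := by
  have hnat : Tendsto (fun n : ℕ => (n : ℝ)) atTop atTop := tendsto_natCast_atTop_atTop
  have hlog := (Real.tendsto_log_atTop.comp hnat).eventually_gt_atTop 0
  choose l hl hl_min using fun n : ℕ =>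
    Finset.exists_min_image (Finset.Ico n (2 * n + 1)) α.a ⟨n, Finset.mem_Ico.2 (by omega)⟩
  have hl₁ {n : ℕ} (hn : 1 ≤ n) : 1 ≤ l n := hn.trans (Finset.mem_Ico.1 (hl n)).1
  have hal : HasExponent (fun n => α.a (l n)) (fun n => n) (-(1 + θ)) := by
    refine hα.comp_of_le_const_mul tendsto_id two_pos
      (Eventually.of_forall fun n => (Finset.mem_Ico.1 (hl n)).1)
      (Eventually.of_forall fun n => ?_)
    exact_mod_cast Nat.le_of_lt_succ (Finset.mem_Ico.1 (hl n)).2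
  have hlower : HasExponent (fun n => n * α.a (l n)) (fun n => n) (-θ) := by
    have := (HasExponent.refl hnat).mul hal (hnat.eventually_ne_atTop 0)
      ((eventually_ge_atTop 1).mono fun n hn => (α.a_pos _ (hl₁ hn)).ne')
    rwa [neg_add, add_neg_cancel_left] at this
  refine tendsto_order.2 ⟨fun c hc => ?_, fun c hc => ?_⟩
  · filter_upwards [hlower.eventually_const_lt hc, eventually_ge_atTop 1, hlog]
      with n hcn hn hlog_n
    have hle : n * α.a (l n) ≤ α.t n := by
      refine (Finset.card_nsmul_le_sum _ _ _ (hl_min n)).trans' ?_ |>.trans (α.sum_Ico_a_le_t hn _)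
      rw [Nat.card_Ico, nsmul_eq_mul]
      exact mul_le_mul_of_nonneg_right (by exact_mod_cast (by omega : n ≤ 2 * n + 1 - n))
        (α.a_pos _ (hl₁ hn)).le
    have hpos : 0 < n * α.a (l n) := mul_pos (by exact_mod_cast hn) (α.a_pos _ (hl₁ hn))
    exact hcn.trans_le (div_le_div_of_nonneg_right (Real.log_le_log hpos hle) hlog_n.le)
  · obtain ⟨d, hd, hdc⟩ := exists_between (lt_min hc (neg_lt_zero.2 hθ))
    rw [lt_min_iff] at hdc
    filter_upwards [eventually_t_le_rpow hα hd hdc.2.le, eventually_ge_atTop 1, hlog]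
      with n ht hn hlog_n
    refine lt_of_le_of_lt ((div_le_iff₀ hlog_n).2 ?_) hdc.1
    rw [Function.comp_apply, ← Real.log_rpow (by exact_mod_cast hn)]
    exact Real.log_le_log (α.t_pos hn) ht

end LurothPartition

/-! ### The admissible digits -/

/-- The digits allowed at position `k + 1`, for points of the Jarník set of `s` and `N`. -/
def digits (s : ℕ → ℕ) (N : ℝ) (k : ℕ) : Finset ℕ := Finset.Ico (s (k + 1)) ⌈N * s (k + 1)⌉₊

/-- The number of admissible digits at position `k + 1`, the radix by which the points of the Jarník
set are coded at that position. -/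
def numDigits (s : ℕ → ℕ) (N : ℝ) (k : ℕ) : ℕ := (digits s N k).card

section digits

variable {s : ℕ → ℕ} {N : ℝ}

lemma mem_digits {k l : ℕ} : l ∈ digits s N k ↔ s (k + 1) ≤ l ∧ (l : ℝ) < N * s (k + 1) := by
  rw [digits, Finset.mem_Ico, Nat.lt_ceil]

lemma one_le_of_mem_digits (hs_pos : ∀ n, 1 ≤ n → 1 ≤ s n) {k l : ℕ} (hl : l ∈ digits s N k) :
    1 ≤ l :=
  (hs_pos _ (Nat.le_add_left 1 k)).trans (mem_digits.1 hl).1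

lemma digits_nonempty (hs_pos : ∀ n, 1 ≤ n → 1 ≤ s n) (hN : 1 < N) (k : ℕ) :
    (digits s N k).Nonempty :=
  ⟨s (k + 1), mem_digits.2 ⟨le_rfl, lt_mul_of_one_lt_left
    (by exact_mod_cast hs_pos _ (Nat.le_add_left 1 k)) hN⟩⟩

lemma hasExponent_of_mem_digits {f : ℕ → ℝ} {c : ℝ} (hf : HasExponent f (fun n => n) c)
    (hs : Tendsto s atTop atTop) (hN : 0 < N) {l : ℕ → ℕ} (hl : ∀ k, l k ∈ digits s N k) :
    HasExponent (fun k => f (l k)) (fun k => s (k + 1)) c :=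
  hf.comp_of_le_const_mul (hs.comp (tendsto_add_atTop_nat 1)) hN
    (Eventually.of_forall fun k => (mem_digits.1 (hl k)).1)
    (Eventually.of_forall fun k => (mem_digits.1 (hl k)).2.le)

lemma numDigits_pos (hs_pos : ∀ n, 1 ≤ n → 1 ≤ s n) (hN : 1 < N) (k : ℕ) : 0 < numDigits s N k :=
  (digits_nonempty hs_pos hN k).card_pos

lemma numDigits_eq (hN : 1 ≤ N) (k : ℕ) :
    (numDigits s N k : ℝ) = ⌈N * s (k + 1)⌉₊ - s (k + 1) := by
  rw [numDigits, digits, Nat.card_Ico, Nat.cast_sub]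
  exact_mod_cast (le_mul_of_one_le_left (Nat.cast_nonneg _) hN).trans (Nat.le_ceil _)

lemma sub_one_mul_le_numDigits (hN : 1 ≤ N) (k : ℕ) : (N - 1) * s (k + 1) ≤ numDigits s N k := by
  rw [numDigits_eq hN]
  linarith [Nat.le_ceil (N * s (k + 1))]

lemma numDigits_le_mul (hs_pos : ∀ n, 1 ≤ n → 1 ≤ s n) (hN : 1 ≤ N) (k : ℕ) :
    numDigits s N k ≤ N * s (k + 1) := by
  have hs₁ : (1 : ℝ) ≤ s (k + 1) := by exact_mod_cast hs_pos _ (Nat.le_add_left 1 k)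
  rw [numDigits_eq hN]
  linarith [Nat.ceil_lt_add_one (R := ℝ) (a := N * s (k + 1)) (by positivity)]

lemma tendsto_numDigits (hs : Tendsto s atTop atTop) (hN : 1 < N) :
    Tendsto (numDigits s N) atTop atTop :=
  tendsto_natCast_atTop_iff.1 <| tendsto_atTop_mono (sub_one_mul_le_numDigits hN.le) <|
    (tendsto_natCast_atTop_atTop.comp (hs.comp (tendsto_add_atTop_nat 1))).const_mul_atTop
      (sub_pos.2 hN)

lemma hasExponent_numDigits (hs_pos : ∀ n, 1 ≤ n → 1 ≤ s n) (hs : Tendsto s atTop atTop)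
    (hN : 1 < N) : HasExponent (fun k => numDigits s N k) (fun k => s (k + 1)) 1 :=
  HasExponent.of_le_const_mul
    (tendsto_natCast_atTop_atTop.comp (hs.comp (tendsto_add_atTop_nat 1))) (sub_pos.2 hN)
    (zero_lt_one.trans hN) (Eventually.of_forall (sub_one_mul_le_numDigits hN.le))
    (Eventually.of_forall (numDigits_le_mul hs_pos hN.le))

end digits

/-! ### Orbits and their digits -/

namespace LurothPartition

section branches

variable (α : LurothPartition)

lemma t_le_one {n : ℕ} (hn : 1 ≤ n) : α.t n ≤ 1 :=
  α.t_one ▸ α.antitoneOn_t (Set.mem_Ici.2 le_rfl) hn hn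

lemma t_two : α.t 2 = 1 - α.a 1 := by
  rw [← α.t_one, α.t_eq_add le_rfl, add_sub_cancel_left]

lemma t_sub_mul_mem_Icc {n : ℕ} (hn : 1 ≤ n) {z : ℝ} (hz : z ∈ Set.Icc (0 : ℝ) 1) :
    α.t n - α.a n * z ∈ Set.Icc (α.t (n + 1)) (α.t n) := by
  rw [α.t_eq_add hn]
  have := mul_le_of_le_one_right (α.a_pos n hn).le hz.2
  have := mul_nonneg (α.a_pos n hn).le hz.1
  constructor <;> linarith

lemma Icc_t_subset {n : ℕ} (hn : 1 ≤ n) : Set.Icc (α.t (n + 1)) (α.t n) ⊆ Set.Icc 0 1 :=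
  Set.Icc_subset_Icc (α.t_pos (Nat.le_add_left 1 n)).le (α.t_le_one hn)

end branches

variable {α : LurothPartition} {l l' : ℕ → ℕ} {x y : ℕ → ℝ} {s : ℕ → ℕ} {N : ℝ}

lemma mem_atom_digit {z : ℝ} (hz : 1 ≤ α.digit z) : z ∈ α.atom (α.digit z) :=
  (Nat.sInf_mem (Nat.nonempty_of_pos_sInf hz)).2

lemma digit_eq_of_mem_atom {z : ℝ} {n : ℕ} (hn : 1 ≤ n) (hz : z ∈ α.atom n) : α.digit z = n := by
  obtain ⟨-, hmem⟩ := Nat.sInf_mem (s := {n | 1 ≤ n ∧ z ∈ α.atom n}) ⟨n, hn, hz⟩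
  refine (Nat.sInf_le ⟨hn, hz⟩ : α.digit z ≤ n).eq_of_not_lt fun hlt => ?_
  exact (hz.2.trans (α.antitoneOn_t (Nat.le_add_left 1 _) hn hlt)).not_gt hmem.1

lemma eq_t_sub_mul_map {z : ℝ} (hz : 1 ≤ α.digit z) :
    z = α.t (α.digit z) - α.a (α.digit z) * α.map z := by
  rw [map, if_neg (Nat.one_le_iff_ne_zero.1 hz), mul_div_cancel₀ _ (α.a_pos _ hz).ne',
    sub_sub_cancel]

/-- `x` is a sequence in `[0,1]` in which each term is the image of the next one under the inverse
branch `z ↦ t_l - a_l z` of the Lüroth map that belongs to the digit `l = l k`. -/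
def IsOrbit (α : LurothPartition) (l : ℕ → ℕ) (x : ℕ → ℝ) : Prop :=
  ∀ k, x k ∈ Set.Icc (0 : ℝ) 1 ∧ x k = α.t (l k) - α.a (l k) * x (k + 1)

lemma exists_partial_orbit (n : ℕ) (hl : ∀ k, 1 ≤ l k) :
    ∃ x : ℕ → ℝ, (∀ k, x k ∈ Set.Icc (0 : ℝ) 1) ∧
      ∀ k < n, x k = α.t (l k) - α.a (l k) * x (k + 1) := by
  induction n generalizing l with
  | zero => exact ⟨0, fun _ => ⟨le_rfl, zero_le_one⟩, fun _ hk => absurd hk (Nat.not_lt_zero _)⟩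
  | succ n ih =>
    obtain ⟨x, hxI, hx⟩ := ih fun k => hl (k + 1)
    refine ⟨fun k => k.casesOn (α.t (l 0) - α.a (l 0) * x 0) x, fun k => ?_, fun k hk => ?_⟩
    · cases k with
      | zero => exact α.Icc_t_subset (hl 0) (α.t_sub_mul_mem_Icc (hl 0) (hxI 0))
      | succ k => exact hxI k
    · cases k with
      | zero => rfl
      | succ k => exact hx k (Nat.succ_lt_succ_iff.1 hk)

lemma exists_isOrbit (hl : ∀ k, 1 ≤ l k) : ∃ x, α.IsOrbit l x := by
  let cube : Set (ℕ → ℝ) := Set.univ.pi fun _ => Set.Icc 0 1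
  let K (n : ℕ) : Set (ℕ → ℝ) :=
    cube ∩ {x | ∀ k < n, x k = α.t (l k) - α.a (l k) * x (k + 1)}
  have hcube : IsCompact cube := isCompact_univ_pi fun _ => isCompact_Icc
  have hK_closed (n : ℕ) : IsClosed (K n) := hcube.isClosed.inter <| by
    simp only [Set.ofPred_forall]
    exact isClosed_iInter fun k => isClosed_iInter fun _ =>
      isClosed_eq (by fun_prop) (by fun_prop)
  obtain ⟨x, hx⟩ := IsCompact.nonempty_iInter_of_sequence_nonempty_isCompact_isClosed K
    (fun n x hx => ⟨hx.1, fun k hk => hx.2 k (hk.trans n.lt_succ_self)⟩)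
    (fun n => let ⟨x, hxI, hx⟩ := exists_partial_orbit n hl; ⟨x, fun k _ => hxI k, hx⟩)
    (hcube.of_isClosed_subset (hK_closed 0) Set.inter_subset_left) hK_closed
  rw [Set.mem_iInter] at hx
  exact ⟨x, fun k => ⟨(hx 0).1 k trivial, (hx (k + 1)).2 k k.lt_succ_self⟩⟩

lemma IsOrbit.mem_Ioo (hx : α.IsOrbit l x) (hl : ∀ k, 1 ≤ l k) (k : ℕ) :
    x k ∈ Set.Ioo (α.t (l k + 1)) (α.t (l k)) := by
  have hpos (k : ℕ) : 0 < x k := by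
    rw [(hx k).2]
    exact (α.t_pos (Nat.le_add_left 1 _)).trans_le (α.t_sub_mul_mem_Icc (hl k) (hx (k + 1)).1).1
  have hlt (k : ℕ) : x k < α.t (l k) := by
    rw [(hx k).2]
    exact sub_lt_self _ (mul_pos (α.a_pos _ (hl k)) (hpos (k + 1)))
  refine ⟨?_, hlt k⟩
  have := mul_lt_of_lt_one_right (α.a_pos _ (hl k)) ((hlt (k + 1)).trans_le (α.t_le_one (hl _)))
  linarith [(hx k).2, α.t_eq_add (hl k)]

lemma IsOrbit.digit_eq (hx : α.IsOrbit l x) (hl : ∀ k, 1 ≤ l k) (k : ℕ) :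
    α.digit (x k) = l k :=
  digit_eq_of_mem_atom (hl k) (Set.Ioo_subset_Ioc_self (hx.mem_Ioo hl k))

lemma IsOrbit.iterate_map (hx : α.IsOrbit l x) (hl : ∀ k, 1 ≤ l k) (k : ℕ) :
    α.map^[k] (x 0) = x k := by
  induction k with
  | zero => rfl
  | succ k ih =>
    rw [Function.iterate_succ_apply', ih, map, hx.digit_eq hl, if_neg (Nat.one_le_iff_ne_zero.1
      (hl k)), (hx k).2, sub_sub_cancel, mul_div_cancel_left₀ _ (α.a_pos _ (hl k)).ne']

lemma isOrbit_iterate_map {z : ℝ} (hz : ∀ n, 1 ≤ n → 1 ≤ α.ell n z) :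
    α.IsOrbit (fun k => α.ell (k + 1) z) (fun k => α.map^[k] z) := fun k => by
  have hdigit : 1 ≤ α.digit (α.map^[k] z) := hz (k + 1) (Nat.le_add_left 1 k)
  refine ⟨α.Icc_t_subset hdigit (Set.Ioc_subset_Icc_self (mem_atom_digit hdigit)), ?_⟩
  dsimp only
  rw [Function.iterate_succ_apply']
  exact eq_t_sub_mul_map hdigit

lemma mem_jarnikSet_iff (hs_pos : ∀ n, 1 ≤ n → 1 ≤ s n) {z : ℝ} :
    z ∈ α.jarnikSet s N ↔ ∃ l x, (∀ k, l k ∈ digits s N k) ∧ α.IsOrbit l x ∧ x 0 = z := by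
  constructor
  · rintro ⟨-, hdigits⟩
    exact ⟨_, _, fun k => mem_digits.2 (hdigits (k + 1) (Nat.le_add_left 1 k)),
      isOrbit_iterate_map fun n hn => (hs_pos n hn).trans (hdigits n hn).1, rfl⟩
  · rintro ⟨l, x, hl, hx, rfl⟩
    have hl₁ (k : ℕ) : 1 ≤ l k := one_le_of_mem_digits hs_pos (hl k)
    refine ⟨⟨(hx 0).1, fun k => ?_⟩, fun n hn => ?_⟩
    · rw [hx.iterate_map hl₁]
      exact ((α.t_pos (Nat.le_add_left 1 _)).trans (hx.mem_Ioo hl₁ k).1).ne'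
    · obtain ⟨k, rfl⟩ := Nat.exists_eq_add_of_le' hn
      rw [ell, Nat.add_sub_cancel, hx.iterate_map hl₁, hx.digit_eq hl₁]
      exact mem_digits.1 (hl k)

lemma IsOrbit.abs_sub_eq (hx : α.IsOrbit l x) (hy : α.IsOrbit l' y) (hl : ∀ k, 1 ≤ l k) {n : ℕ}
    (hll' : ∀ k < n, l k = l' k) :
    |x 0 - y 0| = (∏ k ∈ Finset.range n, α.a (l k)) * |x n - y n| := by
  induction n with
  | zero => rw [Finset.prod_range_zero, one_mul]
  | succ n ih =>
    have hstep : x n - y n = -(α.a (l n) * (x (n + 1) - y (n + 1))) := by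
      rw [(hx n).2, (hy n).2, ← hll' n n.lt_succ_self]
      ring
    rw [ih fun k hk => hll' k (hk.trans n.lt_succ_self), hstep, abs_neg, abs_mul,
      abs_of_pos (α.a_pos _ (hl n)), Finset.prod_range_succ, mul_assoc]

/-- If the next digit of `x` is not `1`, then `x` stays away from the end point `t_{l+1}` of its
atom, up to which the atoms of larger digits may come. -/
lemma IsOrbit.mul_sum_Ico_le_sub (hx : α.IsOrbit l x) (hy : α.IsOrbit l' y) (hl : ∀ k, 1 ≤ l k)
    (hl' : ∀ k, 1 ≤ l' k) {n : ℕ} (hn : l n < l' n) (hn' : 2 ≤ l (n + 1)) :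
    α.a 1 * ∑ i ∈ Finset.Ico (l n) (l' n), α.a i ≤ x n - y n := by
  have hy_lt : y n < α.t (l' n) := (hy.mem_Ioo hl' n).2
  have hx_succ : x (n + 1) ≤ 1 - α.a 1 := by
    rw [← α.t_two]
    exact (hx.mem_Ioo hl (n + 1)).2.le.trans
      (α.antitoneOn_t (show 1 ≤ 2 by norm_num) (hl (n + 1)) hn')
  have ha_le : α.a (l n) ≤ ∑ i ∈ Finset.Ico (l n) (l' n), α.a i :=
    Finset.single_le_sum (fun i hi => (α.a_pos i ((hl n).trans (Finset.mem_Ico.1 hi).1)).le)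
      (Finset.mem_Ico.2 ⟨le_rfl, hn⟩)
  have hprod : α.a (l n) * x (n + 1) ≤ (1 - α.a 1) * ∑ i ∈ Finset.Ico (l n) (l' n), α.a i := by
    rw [mul_comm]
    exact mul_le_mul hx_succ ha_le (α.a_pos _ (hl n)).le ((hx (n + 1)).1.1.trans hx_succ)
  linarith [(hx n).2, α.t_eq_sum_Ico_add (hl n) hn.le]

end LurothPartition

/-! ### The upper bound -/

namespace LurothPartition

variable {α : LurothPartition} {θ : ℝ} {s : ℕ → ℕ} {N : ℝ}

lemma hasExponent_prod_a_digits (hα : HasExponent α.a (fun n => n) (-(1 + θ)))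
    (hs_pos : ∀ n, 1 ≤ n → 1 ≤ s n) (hs : Tendsto s atTop atTop) (hN : 0 < N) {l : ℕ → ℕ}
    (hl : ∀ k, l k ∈ digits s N k) :
    HasExponent (fun n => ∏ k ∈ Finset.range n, α.a (l k)) (rangeProd fun k => s (k + 1))
      (-(1 + θ)) :=
  (hasExponent_of_mem_digits hα hs hN hl).prod_range
    (fun k => (α.a_pos _ (one_le_of_mem_digits hs_pos (hl k))).ne')
    (fun k => by exact_mod_cast hs_pos _ (Nat.le_add_left 1 k))
    (tendsto_natCast_atTop_atTop.comp (hs.comp (tendsto_add_atTop_nat 1)))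

lemma hasExponent_rangeProd_numDigits (hs_pos : ∀ n, 1 ≤ n → 1 ≤ s n)
    (hs : Tendsto s atTop atTop) (hN : 1 < N) :
    HasExponent (rangeProd (numDigits s N)) (rangeProd fun k => s (k + 1)) 1 :=
  (hasExponent_numDigits hs_pos hs hN).prod_range
    (fun k => by exact_mod_cast (numDigits_pos hs_pos hN k).ne')
    (fun k => by exact_mod_cast hs_pos _ (Nat.le_add_left 1 k))
    (tendsto_natCast_atTop_atTop.comp (hs.comp (tendsto_add_atTop_nat 1)))

lemma prod_a_pos {l : ℕ → ℕ} (hl : ∀ k, 1 ≤ l k) (n : ℕ) :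
    0 < ∏ k ∈ Finset.range n, α.a (l k) :=
  Finset.prod_pos fun k _ => α.a_pos _ (hl k)

lemma a_le_t {n : ℕ} (hn : 1 ≤ n) : α.a n ≤ α.t n := by
  rw [α.t_eq_add hn]
  exact le_add_of_nonneg_right (α.t_pos (Nat.le_add_left 1 n)).le

variable (α s N) in
/-- The points of the Jarník set whose expansion starts with the word `w` of length `n`. -/
def cylinder (n : ℕ) (w : ∀ k : Fin n, digits s N k) : Set ℝ :=
  {z | ∃ l x, (∀ k, l k ∈ digits s N k) ∧ α.IsOrbit l x ∧ x 0 = z ∧ ∀ k : Fin n, l k = w k}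

lemma jarnikSet_subset_iUnion_cylinder (hs_pos : ∀ n, 1 ≤ n → 1 ≤ s n) (n : ℕ) :
    α.jarnikSet s N ⊆ ⋃ w, α.cylinder s N n w := fun z hz => by
  obtain ⟨l, x, hl, hx, hxz⟩ := (mem_jarnikSet_iff hs_pos).1 hz
  exact Set.mem_iUnion.2 ⟨fun k => ⟨l k, hl k⟩, l, x, hl, hx, hxz, fun _ => rfl⟩

lemma dist_le_of_mem_cylinder (hs_pos : ∀ n, 1 ≤ n → 1 ≤ s n) {b : ℕ → ℕ}
    (hb : ∀ k, ∀ i ∈ digits s N k, α.a i ≤ α.a (b k)) {n : ℕ} {w : ∀ k : Fin n, digits s N k}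
    {z z' : ℝ} (hz : z ∈ α.cylinder s N n w) (hz' : z' ∈ α.cylinder s N n w) :
    dist z z' ≤ (∏ k ∈ Finset.range n, α.a (b k)) * α.t (s (n + 1)) := by
  obtain ⟨l, x, hl, hx, rfl, hlw⟩ := hz
  obtain ⟨l', y, hl', hy, rfl, hlw'⟩ := hz'
  have hl₁ (k : ℕ) : 1 ≤ l k := one_le_of_mem_digits hs_pos (hl k)
  have hagree (k : ℕ) (hk : k < n) : l k = l' k := (hlw ⟨k, hk⟩).trans (hlw' ⟨k, hk⟩).symm
  have hle {l : ℕ → ℕ} {x : ℕ → ℝ} (hl : ∀ k, l k ∈ digits s N k) (hx : α.IsOrbit l x) :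
      x n ≤ α.t (s (n + 1)) :=
    (hx.mem_Ioo (fun k => one_le_of_mem_digits hs_pos (hl k)) n).2.le.trans
      (α.antitoneOn_t (hs_pos _ (Nat.le_add_left 1 n)) (one_le_of_mem_digits hs_pos (hl n))
        (mem_digits.1 (hl n)).1)
  rw [Real.dist_eq, hx.abs_sub_eq hy hl₁ hagree]
  exact mul_le_mul
    (Finset.prod_le_prod (fun k _ => (α.a_pos _ (hl₁ k)).le) fun k _ => hb k _ (hl k))
    (abs_sub_le_of_nonneg_of_le (hx n).1.1 (hle hl hx) (hy n).1.1 (hle hl' hy)) (abs_nonneg _)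
    (Finset.prod_nonneg fun k _ => (α.a_pos _ (hl₁ k)).le.trans (hb k _ (hl k)))

lemma tendsto_prod_a_mul_t (hs_pos : ∀ n, 1 ≤ n → 1 ≤ s n) (hs : Tendsto s atTop atTop)
    {l : ℕ → ℕ} (hl : ∀ k, 1 ≤ l k) :
    Tendsto (fun n => (∏ k ∈ Finset.range n, α.a (l k)) * α.t (s (n + 1))) atTop (𝓝 0) := by
  have ht (n : ℕ) : 0 ≤ α.t (s (n + 1)) := (α.t_pos (hs_pos _ (Nat.le_add_left 1 n))).le
  refine squeeze_zero (fun n => mul_nonneg (prod_a_pos hl n).le (ht n)) (fun n => ?_)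
    (α.tendsto_t.comp (hs.comp (tendsto_add_atTop_nat 1)))
  exact mul_le_of_le_one_left (ht n) (Finset.prod_le_one (fun k _ => (α.a_pos _ (hl k)).le)
    fun k _ => (a_le_t (hl k)).trans (α.t_le_one (hl k)))

theorem dimH_jarnikSet_le (hθ : 0 < θ) (hα : HasExponent α.a (fun n => n) (-(1 + θ)))
    (hs_pos : ∀ n, 1 ≤ n → 1 ≤ s n) (hs : Tendsto s atTop atTop) (hN : 1 < N) :
    dimH (α.jarnikSet s N) ≤ ENNReal.ofReal (jarnikExponent s θ) := by
  refine le_of_not_gt fun hlt => ?_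
  obtain ⟨d, hσd, hd⟩ := ENNReal.lt_iff_exists_nnreal_btwn.1 hlt
  rw [ENNReal.ofReal_lt_coe_iff (jarnikExponent_mem_Icc hθ.le hs_pos).1,
    jarnikExponent_eq_liminf] at hσd
  choose b hb hb_max using fun k =>
    Finset.exists_max_image (digits s N k) α.a (digits_nonempty hs_pos hN k)
  have hb₁ (k : ℕ) : 1 ≤ b k := one_le_of_mem_digits hs_pos (hb k)
  have hs_succ : Tendsto (fun k => s (k + 1)) atTop atTop := hs.comp (tendsto_add_atTop_nat 1)
  have hs_succ_pos (k : ℕ) : 0 < s (k + 1) := hs_pos _ (Nat.le_add_left 1 k)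
  have ht₀ (n : ℕ) : 0 < α.t (s (n + 1)) := α.t_pos (hs_succ_pos n)
  have hsum := frequently_mul_rpow_le_one hθ (tendsto_rangeProd hs_succ_pos hs_succ)
    (tendsto_natCast_atTop_atTop.comp hs_succ) (hasExponent_rangeProd_numDigits hs_pos hs hN)
    (hasExponent_prod_a_digits hα hs_pos hs (zero_lt_one.trans hN) hb)
    ((hasExponent_t hθ hα).comp hs_succ)
    (fun n => zero_lt_one.trans_le (one_le_rangeProd (numDigits_pos hs_pos hN) n))
    (prod_a_pos hb₁) ht₀ hσd
  have hcard (n : ℕ) : (Fintype.card (∀ k : Fin n, digits s N k) : ℝ) =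
      rangeProd (numDigits s N) n := by
    simp only [Fintype.card_pi, Fintype.card_coe, Nat.cast_prod, rangeProd]
    exact Fin.prod_univ_eq_prod_range (fun k => (numDigits s N k : ℝ)) n
  refine hd.not_ge (dimH_le_of_frequently_card_mul_rpow_le
    (fun n => (mul_pos (prod_a_pos hb₁ n) (ht₀ n)).le) (tendsto_prod_a_mul_t hs_pos hs hb₁)
    (fun n w z hz z' hz' => dist_le_of_mem_cylinder hs_pos hb_max hz hz')
    (jarnikSet_subset_iUnion_cylinder hs_pos) (hsum.mono fun n hn => ?_))
  rwa [hcard]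

end LurothPartition

/-! ### The lower bound -/

lemma le_rpow_of_one_le_mul_rpow {δ D u W Z d : ℝ} (hδ : 0 ≤ δ) (hu : u ≤ 1) (hW : 0 ≤ W)
    (hZ : 0 ≤ Z) (hd : 0 ≤ d) (hd₁ : d ≤ 1) (hWZ : 1 ≤ W * Z ^ d) (hδu : δ * W ≤ u)
    (huD : u * Z ≤ D) : δ ≤ D ^ d := by
  have hu₀ : 0 ≤ u := (mul_nonneg hδ hW).trans hδu
  have hZd : 0 ≤ Z ^ d := Real.rpow_nonneg hZ d
  calc δ ≤ δ * (W * Z ^ d) := le_mul_of_one_le_right hδ hWZ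
    _ ≤ u * Z ^ d := by
        rw [← mul_assoc]
        exact mul_le_mul_of_nonneg_right hδu hZd
    _ ≤ u ^ d * Z ^ d :=
        mul_le_mul_of_nonneg_right (Real.self_le_rpow_of_le_one hu₀ hu hd₁) hZd
    _ = (u * Z) ^ d := (Real.mul_rpow hu₀ hZ).symm
    _ ≤ D ^ d := Real.rpow_le_rpow (mul_nonneg hu₀ hZ) huD hd

/-- The admissible digit at position `k + 1` that codes the `k`-th mixed radix digit of `y`. -/
def codeDigit (s : ℕ → ℕ) (N : ℝ) (y : ℝ) (k : ℕ) : ℕ :=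
  s (k + 1) + mixedRadixDigit (numDigits s N) k y

namespace LurothPartition

variable {α : LurothPartition} {θ : ℝ} {s : ℕ → ℕ} {N : ℝ}

lemma IsOrbit.le_abs_sub {b l l' : ℕ → ℕ} {x y : ℕ → ℝ} (hs_pos : ∀ n, 1 ≤ n → 1 ≤ s n)
    (hb : ∀ k, 1 ≤ b k) (hb_min : ∀ k, ∀ i ∈ digits s N k, α.a (b k) ≤ α.a i)
    (hx : α.IsOrbit l x) (hy : α.IsOrbit l' y) (hl : ∀ k, l k ∈ digits s N k)
    (hl' : ∀ k, l' k ∈ digits s N k) {n : ℕ} (hagree : ∀ k < n, l k = l' k) (hn : l n < l' n)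
    (hs₂ : 2 ≤ s (n + 2)) :
    (∏ k ∈ Finset.range n, α.a (b k)) * (α.a 1 * (((l' n : ℝ) - l n) * α.a (b n))) ≤
      |x 0 - y 0| := by
  have hl₁ (k : ℕ) : 1 ≤ l k := one_le_of_mem_digits hs_pos (hl k)
  have hsum : ((l' n : ℝ) - l n) * α.a (b n) ≤ ∑ i ∈ Finset.Ico (l n) (l' n), α.a i := by
    have hmem : ∀ i ∈ Finset.Ico (l n) (l' n), i ∈ digits s N n := fun i hi => by
      obtain ⟨hli, hil'⟩ := Finset.mem_Ico.1 hi
      exact mem_digits.2 ⟨(mem_digits.1 (hl n)).1.trans hli,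
        (Nat.cast_lt.2 hil').trans (mem_digits.1 (hl' n)).2⟩
    have := Finset.card_nsmul_le_sum _ _ _ fun i hi => hb_min n i (hmem i hi)
    rwa [Nat.card_Ico, nsmul_eq_mul, Nat.cast_sub hn.le] at this
  rw [hx.abs_sub_eq hy hl₁ hagree]
  refine mul_le_mul
    (Finset.prod_le_prod (fun k _ => (α.a_pos _ (hb k)).le) fun k _ => hb_min k _ (hl k)) ?_
    (mul_nonneg (α.a_pos 1 le_rfl).le
      (mul_nonneg (sub_nonneg.2 (Nat.cast_le.2 hn.le)) (α.a_pos _ (hb n)).le))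
    (prod_a_pos hl₁ n).le
  calc α.a 1 * (((l' n : ℝ) - l n) * α.a (b n))
      ≤ α.a 1 * ∑ i ∈ Finset.Ico (l n) (l' n), α.a i :=
        mul_le_mul_of_nonneg_left hsum (α.a_pos 1 le_rfl).le
    _ ≤ x n - y n := hx.mul_sum_Ico_le_sub hy hl₁
        (fun k => one_le_of_mem_digits hs_pos (hl' k)) hn (hs₂.trans (mem_digits.1 (hl (n + 1))).1)
    _ ≤ |x n - y n| := le_abs_self _

lemma codeDigit_mem_digits (hs_pos : ∀ n, 1 ≤ n → 1 ≤ s n) (hN : 1 < N) (y : ℝ) (k : ℕ) :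
    codeDigit s N y k ∈ digits s N k := by
  have hlt := mixedRadixDigit_lt (numDigits_pos hs_pos hN) k y
  rw [numDigits, digits, Nat.card_Ico] at hlt
  exact Finset.mem_Ico.2 ⟨Nat.le_add_right _ _, by rw [codeDigit]; omega⟩

/-- `hgap` only concerns points of a cylinder of order `n` whose next digits are as far apart as
possible. Closer digits shrink the gap by a factor `u ≤ 1`, and `u ≤ u ^ d`. -/
lemma sub_le_abs_sub_rpow {x : ℝ → ℕ → ℝ} {b : ℕ → ℕ} (hs_pos : ∀ n, 1 ≤ n → 1 ≤ s n)
    (hs : Tendsto s atTop atTop) (hN : 1 < N)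
    (hx : ∀ y, α.IsOrbit (codeDigit s N y) (x y))
    (hb : ∀ k, 1 ≤ b k) (hb_min : ∀ k, ∀ i ∈ digits s N k, α.a (b k) ≤ α.a i)
    {d : ℝ} (hd : 0 ≤ d) (hd₁ : d ≤ 1) {n₀ : ℕ} (hs₂ : ∀ n ≥ n₀, 2 ≤ s n)
    (hgap : ∀ n ≥ n₀, 1 ≤ 1 / 2 * rangeProd (numDigits s N) n *
      ((∏ k ∈ Finset.range n, α.a (b k)) *
        (α.a 1 * (numDigits s N n * α.a (b n)))) ^ d)
    {y y' : ℝ} (hy : 0 ≤ y) (hyy' : y < y')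
    (hy' : rangeProd (numDigits s N) n₀ * y' < 1) :
    y' - y ≤ |x y 0 - x y' 0| ^ d := by
  obtain ⟨n, hn, hagree, hlt, hle⟩ := exists_mixedRadixDigit_lt (numDigits_pos hs_pos hN)
    (tendsto_rangeProd (numDigits_pos hs_pos hN) (tendsto_numDigits hs hN)) hy hyy' hy'
  have hradix : (0 : ℝ) < numDigits s N n := by exact_mod_cast numDigits_pos hs_pos hN n
  have hdist := (hx y).le_abs_sub hs_pos hb hb_min (hx y')
    (codeDigit_mem_digits hs_pos hN y) (codeDigit_mem_digits hs_pos hN y')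
    (fun k hk => congrArg _ (hagree k hk)) (Nat.add_lt_add_left hlt _) (hs₂ (n + 2) (by omega))
  refine le_rpow_of_one_le_mul_rpow (sub_nonneg.2 hyy'.le)
    (u := ((mixedRadixDigit (numDigits s N) n y' : ℝ) - mixedRadixDigit (numDigits s N) n y) /
      numDigits s N n) ?_ (mul_nonneg one_half_pos.le (rangeProd_nonneg _ n))
    (mul_pos (prod_a_pos hb n) (mul_pos (α.a_pos 1 le_rfl) (mul_pos hradix (α.a_pos _ (hb n))))).le
    hd hd₁ (hgap n hn) ?_ (hdist.trans' (le_of_eq ?_))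
  · have : (mixedRadixDigit (numDigits s N) n y' : ℝ) < numDigits s N n := by
      exact_mod_cast mixedRadixDigit_lt (numDigits_pos hs_pos hN) n y'
    rw [div_le_one hradix]
    linarith [Nat.cast_nonneg (α := ℝ) (mixedRadixDigit (numDigits s N) n y)]
  · rw [rangeProd_succ] at hle
    rw [le_div_iff₀ hradix]
    linarith
  · rw [codeDigit, codeDigit, Nat.cast_add, Nat.cast_add, add_sub_add_left_eq_sub]
    field_simp

lemma eventually_one_le_half_rangeProd_mul_rpow (hθ : 0 < θ)
    (hα : HasExponent α.a (fun n => n) (-(1 + θ))) (hs_pos : ∀ n, 1 ≤ n → 1 ≤ s n)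
    (hs : Tendsto s atTop atTop) (hN : 1 < N) {b : ℕ → ℕ} (hb : ∀ k, b k ∈ digits s N k) {d : ℝ}
    (hd : d < jarnikExponent s θ) :
    ∀ᶠ n in atTop, 1 ≤ 1 / 2 * rangeProd (numDigits s N) n *
      ((∏ k ∈ Finset.range n, α.a (b k)) * (α.a 1 * (numDigits s N n * α.a (b n)))) ^ d := by
  have hb₁ (k : ℕ) : 1 ≤ b k := one_le_of_mem_digits hs_pos (hb k)
  have hs_succ : Tendsto (fun k => s (k + 1)) atTop atTop := hs.comp (tendsto_add_atTop_nat 1)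
  have hs_top : Tendsto (fun k => (s (k + 1) : ℝ)) atTop atTop :=
    tendsto_natCast_atTop_atTop.comp hs_succ
  have hs_prod := tendsto_rangeProd (fun k => hs_pos _ (Nat.le_add_left 1 k)) hs_succ
  have hm₀ (n : ℕ) : (0 : ℝ) < numDigits s N n := by exact_mod_cast numDigits_pos hs_pos hN n
  have hM₀ (n : ℕ) : 0 < rangeProd (numDigits s N) n :=
    zero_lt_one.trans_le (one_le_rangeProd (numDigits_pos hs_pos hN) n)
  have hma₀ (n : ℕ) : 0 < numDigits s N n * α.a (b n) := mul_pos (hm₀ n) (α.a_pos _ (hb₁ n))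
  have hma : HasExponent (fun n => numDigits s N n * α.a (b n)) (fun n => s (n + 1)) (-θ) := by
    have := (hasExponent_numDigits hs_pos hs hN).mul
      (hasExponent_of_mem_digits hα hs (zero_lt_one.trans hN) hb)
      (Eventually.of_forall fun n => (hm₀ n).ne')
      (Eventually.of_forall fun n => (α.a_pos _ (hb₁ n)).ne')
    rwa [neg_add, add_neg_cancel_left] at this
  rw [jarnikExponent_eq_liminf] at hd
  exact eventually_one_le_mul_rpow hθ hs_prod hs_top
    ((hasExponent_rangeProd_numDigits hs_pos hs hN).const_mul hs_prod
      (Eventually.of_forall fun n => (hM₀ n).ne') one_half_pos.ne')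
    (hasExponent_prod_a_digits hα hs_pos hs (zero_lt_one.trans hN) hb)
    (hma.const_mul hs_top (Eventually.of_forall fun n => (hma₀ n).ne') (α.a_pos 1 le_rfl).ne')
    (fun n => mul_pos one_half_pos (hM₀ n)) (prod_a_pos hb₁)
    (fun n => mul_pos (α.a_pos 1 le_rfl) (hma₀ n)) hd

lemma exists_dist_le_dist_rpow (hθ : 0 < θ) (hα : HasExponent α.a (fun n => n) (-(1 + θ)))
    (hs_pos : ∀ n, 1 ≤ n → 1 ≤ s n) (hs : Tendsto s atTop atTop) (hN : 1 < N) {d : ℝ} (hd₀ : 0 ≤ d)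
    (hd : d < jarnikExponent s θ) :
    ∃ c > 0, ∃ g : ℝ → ℝ, (∀ y, g y ∈ α.jarnikSet s N) ∧
      ∀ y ∈ Set.Ico 0 c, ∀ y' ∈ Set.Ico 0 c, dist y y' ≤ dist (g y) (g y') ^ d := by
  choose b hb hb_min using fun k =>
    Finset.exists_min_image (digits s N k) α.a (digits_nonempty hs_pos hN k)
  have hcode := codeDigit_mem_digits (s := s) hs_pos hN
  choose x hx using fun y => α.exists_isOrbit fun k => one_le_of_mem_digits hs_pos (hcode y k)
  obtain ⟨n₀, hn₀⟩ := eventually_atTop.1 <| (hs.eventually_ge_atTop 2).and <|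
    eventually_one_le_half_rangeProd_mul_rpow hθ hα hs_pos hs hN hb hd
  have hM₀ : 0 < rangeProd (numDigits s N) n₀ :=
    zero_lt_one.trans_le (one_le_rangeProd (numDigits_pos hs_pos hN) n₀)
  have hlt {y y' : ℝ} (hy : 0 ≤ y) (hyy' : y < y') (hy' : y' < 1 / rangeProd (numDigits s N) n₀) :
      y' - y ≤ |x y 0 - x y' 0| ^ d :=
    sub_le_abs_sub_rpow hs_pos hs hN hx (fun k => one_le_of_mem_digits hs_pos (hb k)) hb_min hd₀
      (hd.le.trans (jarnikExponent_mem_Icc hθ.le hs_pos).2) (fun n hn => (hn₀ n hn).1)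
      (fun n hn => (hn₀ n hn).2) hy hyy' ((lt_div_iff₀' hM₀).1 hy')
  refine ⟨1 / rangeProd (numDigits s N) n₀, one_div_pos.2 hM₀, fun y => x y 0,
    fun y => (mem_jarnikSet_iff hs_pos).2 ⟨_, _, hcode y, hx y, rfl⟩, fun y hy y' hy' => ?_⟩
  rcases lt_trichotomy y y' with hyy' | rfl | hyy'
  · rw [dist_comm, Real.dist_eq, Real.dist_eq, abs_of_pos (sub_pos.2 hyy')]
    exact hlt hy.1 hyy' hy'.2
  · rw [dist_self]
    exact Real.rpow_nonneg dist_nonneg d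
  · rw [dist_comm (x y 0), Real.dist_eq, Real.dist_eq, abs_of_pos (sub_pos.2 hyy')]
    exact hlt hy'.1 hyy' hy.2

theorem le_dimH_jarnikSet (hθ : 0 < θ) (hα : HasExponent α.a (fun n => n) (-(1 + θ)))
    (hs_pos : ∀ n, 1 ≤ n → 1 ≤ s n) (hs : Tendsto s atTop atTop) (hN : 1 < N) :
    ENNReal.ofReal (jarnikExponent s θ) ≤ dimH (α.jarnikSet s N) := by
  refine le_of_forall_lt fun c hc => ?_
  obtain ⟨d, hcd, hd⟩ := ENNReal.lt_iff_exists_nnreal_btwn.1 hc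
  have hd₀ : 0 < d := ENNReal.coe_pos.1 (zero_le.trans_lt hcd)
  have hdσ : d < jarnikExponent s θ := ENNReal.lt_ofReal_iff_toReal_lt ENNReal.coe_ne_top |>.1 hd
  obtain ⟨c', hc', g, hgJ, hg⟩ := exists_dist_le_dist_rpow hθ hα hs_pos hs hN d.coe_nonneg hdσ
  have hdim := dimH_le_dimH_image_div_of_dist_le_rpow hd₀ hg
  rw [Real.dimH_of_nonempty_interior (by simpa using hc'), Module.finrank_self, Nat.cast_one,
    ENNReal.le_div_iff_mul_le (Or.inl (ENNReal.coe_pos.2 hd₀).ne') (Or.inl ENNReal.coe_ne_top),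
    one_mul] at hdim
  exact hcd.trans_le (hdim.trans (dimH_mono (Set.image_subset_iff.2 fun y _ => hgJ y)))

end LurothPartition

theorem theorem1p4_general (α : LurothPartition) (θ : ℝ) (hθ : 0 < θ)
    (hα : HasExponent α.a (fun n => n) (-(1 + θ)))
    (s : ℕ → ℕ) (hs_pos : ∀ n, 1 ≤ n → 1 ≤ s n) (hs : Tendsto s atTop atTop)
    (N : ℝ) (hN : 1 < N) :
    dimH (α.jarnikSet s N) = ENNReal.ofReal (jarnikExponent s θ) :=
  le_antisymm (LurothPartition.dimH_jarnikSet_le hθ hα hs_pos hs hN)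
    (LurothPartition.le_dimH_jarnikSet hθ hα hs_pos hs hN)

end

theorem theorem1p4 (α : LurothPartition) (θ : ℝ) (hθ : 0 < θ)
    (hexp : α.IsExpansive θ) (hdec : α.IsEventuallyDecreasing)
    (s : ℕ → ℕ) (hs_pos : ∀ n, 1 ≤ n → 1 ≤ s n) (hs : Tendsto s atTop atTop)
    (N : ℝ) (hN : 3 < N) :
    dimH (α.jarnikSet s N) = ENNReal.ofReal (jarnikExponent s θ) :=
  theorem1p4_general α θ hθ (LurothPartition.hasExponent_a hθ hexp hdec) s hs_pos hs N
    ((by norm_num : (1 : ℝ) < 3).trans hN)
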